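/- For a field $F$ of characteristic different from $2$, let $W(F)$ be its Witt ring, $IF \subseteq W(F)$ the fundamental ideal of classes of even-dimensional forms, $I^nF := (IF)^n$, and let $GP_nF$ be the set of (Witt classes of) forms $c\,\langle 1,a_1\rangle\otimes\cdots\otimes\langle 1,a_n\rangle$ with $c,a_1,\ldots,a_n\in F^\ast$. For $\varphi\in I^nF$ let $$\mathrm{sl}_n(\varphi):=\min\{k\in\mathbb N_0 \mid \exists\, \pi_1,\ldots,\pi_k\in GP_nF:\ \varphi\equiv \pi_1+\cdots+\pi_k \bmod I^{n+1}F\},$$ let $\mathrm{sl}_n(F):=\sup_{\varphi\in I^nF}\mathrm{sl}_n(\varphi)\in\mathbb N_0\cup\{\infty\}$, and let $d_0:=\dim_{\mathbb F_2}(F^\ast/\pm F^{\ast 2})$, where $\pm F^{\ast 2}=F^{\ast2}\cup -F^{\ast2}$. Theorem. For every integer $n\ge 2$ there is a polynomial $f_n\in\mathbb R[X]$ of degree at most $n-2$, depending only on $n$, such that for every field $F$ of characteristic different from $2$ with $|F^\ast/F^{\ast2}|=2^d$ for some $d\in\mathbb N_0$, the symbol length $\mathrm{sl}_n(F)$ is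 finite and $$\mathrm{sl}_n(F)\ \le\ \frac{d_0^{\,n-1}}{2\,(n-1)!}+f_n(d_0).$$ -/

import Mathlib

/-! Witt rings, Pfister forms, symbol lengths and square classes of fields. Quadratic forms are taken
in diagonal shape `⟨w 0, …, w (n - 1)⟩`, that is as `QuadraticMap.weightedSumSquares F w` with
weights in `Fˣ`: over a field of characteristic different from `2` every nondegenerate quadratic form
of finite dimension is isometric to such a form. -/

namespace WittTheory

universe u

variable (F : Type u) [Field F]

/-- The formal sum `∑ i, [w i]` in the group ring `ℤ[Fˣ]` of the entries of a diagonal form. In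
`ℤ[Fˣ]`, addition and multiplication of such sums are the orthogonal sum and the tensor product of
diagonal forms. -/
noncomputable def formalDiag {n : ℕ} (w : Fin n → Fˣ) : MonoidAlgebra ℤ Fˣ :=
  ∑ i, MonoidAlgebra.single (w i) 1

/-- The ideal of `ℤ[Fˣ]` generated by the differences of isometric diagonal forms and by the
hyperbolic plane `⟨1, -1⟩`. -/
noncomputable def wittIdeal : Ideal (MonoidAlgebra ℤ Fˣ) :=
  Ideal.span
    ({x | ∃ (m n : ℕ) (v : Fin m → Fˣ) (w : Fin n → Fˣ),
        (QuadraticMap.weightedSumSquares F v).Equivalent (QuadraticMap.weightedSumSquares F w) ∧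
        x = formalDiag F v - formalDiag F w} ∪
      {formalDiag F ![1, -1]})

/-- The Witt ring `W(F)` (for `char F ≠ 2`): the Grothendieck ring of the isometry classes of
nondegenerate quadratic forms over `F`, with orthogonal sum and tensor product, modulo the ideal
generated by the hyperbolic plane. -/
abbrev WittRing : Type u := MonoidAlgebra ℤ Fˣ ⧸ wittIdeal F

variable {F}

/-- The Witt class of the quadratic form `⟨w 0, …, w (n - 1)⟩`. -/
noncomputable def diag {n : ℕ} (w : Fin n → Fˣ) : WittRing F :=
  Ideal.Quotient.mk (wittIdeal F) (formalDiag F w)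

variable (F)

/-- The dimension modulo `2` on `ℤ[Fˣ]`: it sends every `[a]`, `a ∈ Fˣ`, to `1`. -/
noncomputable def dimModTwoAux : MonoidAlgebra ℤ Fˣ →+* ZMod 2 :=
  (MonoidAlgebra.lift ℤ (ZMod 2) Fˣ 1).toRingHom

theorem dimModTwoAux_formalDiag {n : ℕ} (w : Fin n → Fˣ) :
    dimModTwoAux F (formalDiag F w) = (n : ZMod 2) := by
  simp [dimModTwoAux, formalDiag]

theorem dimModTwoAux_eq_zero (x : MonoidAlgebra ℤ Fˣ) (hx : x ∈ wittIdeal F) :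
    dimModTwoAux F x = 0 := by
  suffices h : wittIdeal F ≤ RingHom.ker (dimModTwoAux F) from h hx
  refine Ideal.span_le.2 ?_
  rintro y (⟨m, n, v, w, ⟨e⟩, rfl⟩ | rfl)
  · have h : m = n := by simpa using e.toLinearEquiv.finrank_eq
    simp [dimModTwoAux_formalDiag, h]
  · simp only [SetLike.mem_coe, RingHom.mem_ker, dimModTwoAux_formalDiag]
    rfl

/-- The dimension index `W(F) → ℤ/2ℤ`, the dimension of a form modulo `2`. -/
noncomputable def dimIndex : WittRing F →+* ZMod 2 :=
  Ideal.Quotient.lift (wittIdeal F) (dimModTwoAux F) (dimModTwoAux_eq_zero F)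

/-- The fundamental ideal `I F` of the Witt classes of forms of even dimension; `I^n F` is its
`n`-th power. -/
noncomputable def fundamentalIdeal : Ideal (WittRing F) := RingHom.ker (dimIndex F)

variable {F}

/-- The Witt class of the `n`-fold Pfister form `⟪a₁, …, aₙ⟫ = ⟨1, a₁⟩ ⊗ ⋯ ⊗ ⟨1, aₙ⟩`. -/
noncomputable def pfister {n : ℕ} (a : Fin n → Fˣ) : WittRing F := ∏ i, diag ![1, a i]

variable (F)

/-- The set `GP_n F` (of Witt classes) of forms `c ⟪a₁, …, aₙ⟫` similar to an `n`-fold Pfister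
form. -/
def generalPfister (n : ℕ) : Set (WittRing F) :=
  {x | ∃ (c : Fˣ) (a : Fin n → Fˣ), x = diag ![c] * pfister a}

variable {F}

/-- The symbol length `sl_n(φ)`: the minimal number `k` of forms in `GP_n F` whose sum is
congruent to `φ` modulo `I^(n+1) F` (and `⊤` if there is no such `k`). -/
noncomputable def symbolLength (n : ℕ) (φ : WittRing F) : ℕ∞ :=
  sInf {l : ℕ∞ | ∃ (k : ℕ) (π : Fin k → WittRing F), l = k ∧
    (∀ i, π i ∈ generalPfister F n) ∧ φ - ∑ i, π i ∈ fundamentalIdeal F ^ (n + 1)}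

variable (F)

/-- The `n`-symbol length `sl_n(F) = sup_{φ ∈ I^n F} sl_n(φ)` of a field. -/
noncomputable def fieldSymbolLength (n : ℕ) : ℕ∞ :=
  ⨆ φ ∈ fundamentalIdeal F ^ n, symbolLength n φ

/-- The group `Fˣ/Fˣ²` of square classes. -/
abbrev SquareClassGroup : Type u := Fˣ ⧸ Subgroup.square Fˣ

/-- The subgroup `±Fˣ² = {a² | a ∈ Fˣ} ∪ {-a² | a ∈ Fˣ}` of `Fˣ`. -/
def signedSquares : Subgroup Fˣ := Subgroup.square Fˣ ⊔ Subgroup.zpowers (-1)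

/-- The group `Fˣ/±Fˣ²`, written additively. -/
abbrev SignedSquareClassGroup : Type u := Additive (Fˣ ⧸ signedSquares F)

theorem two_nsmul_signedSquareClass (x : SignedSquareClassGroup F) : (2 : ℕ) • x = 0 := by
  have h : ∀ y : Fˣ ⧸ signedSquares F, y ^ 2 = 1 := by
    intro y
    induction y using QuotientGroup.induction_on with
    | H z =>
      rw [← QuotientGroup.mk_pow, QuotientGroup.eq_one_iff]
      exact (le_sup_left : Subgroup.square Fˣ ≤ signedSquares F) ⟨z, sq z⟩
  exact congrArg Additive.ofMul (h x.toMul)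

/-- The vector space structure over the field with two elements on `Fˣ/±Fˣ²`. -/
noncomputable instance instModuleSignedSquareClassGroup :
    Module (ZMod 2) (SignedSquareClassGroup F) :=
  AddCommGroup.zmodModule (n := 2) (G := SignedSquareClassGroup F) (two_nsmul_signedSquareClass F)

/-- The invariant `d_0 = dim (Fˣ/±Fˣ²)`, the dimension over the field with two elements. -/
noncomputable def dimSignedSquareClasses : ℕ :=
  Module.finrank (ZMod 2) (SignedSquareClassGroup F)

end WittTheory

/-!
Write `{a} = ⟨1, -a⟩` and `I = I F`. Since `⟨a²⟩ = ⟨1⟩` and `⟨-1⟩ = -⟨1⟩` in the Witt ring, one has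
`{ab} = {a} + {b} - {a}{b}` and `{a}² = 2{a} = {-1}{a}`, and the elements `{a}` generate `I` as a
group. Hence the symbols `{a₁}⋯{aₙ}` generate `Iⁿ` modulo `Iⁿ⁺¹`, where they are additive in each
entry, killed by `2`, and satisfy `{a, a} = {-1, a}`.

For a subspace `P` of `Fˣ/±Fˣ²` of dimension `m`, consider the sums of `n`-fold symbols with entries
in `P` (`symbolGroup P n`), and let `L n m` bound the number of symbols needed to represent them. If
`P` is spanned by a hyperplane `Q` and the class of `e`, then `{e, e} = {-1, e}`, with `-1`
trivial in `Fˣ/±Fˣ²`, allows one to write such a sum as `x + {e} y` with `x` and `y` of degrees `n`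
and `n - 1` and with entries in `Q` (`exists_add_of_mem_symbolGroup`). This gives the recursion
`L n m ≤ L n (m - 1) + L (n - 1) (m - 1)`.

The leading coefficient comes from degree two (`exists_of_mem_symbolGroup_two`), where
`L 2 m ≤ m / 2 + 1`. There `y = {a}` modulo `I²` for a single `a`. If `a` is trivial, then `{e} y` is absorbed
into one symbol `{-1, c}`, which is collected over all steps. Otherwise `Q` is spanned by
a hyperplane `R` and `a`, so that `x = x' + {a, b}` and `x + {e, a} = x' + {a, be}` modulo `I³`: a
single symbol lowers the dimension by two.

By Pascal's rule, `L n m ≤ (m choose (n - 1)) / 2 + ∑ j < n - 1, (m choose j)`, and estimating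
binomial coefficients by powers gives the theorem with `fₙ = 1 + X + ⋯ + X ^ (n - 2)`.
-/

namespace WittTheory

/-! ### Rings generated by one-dimensional classes -/

section Abstract

/-- The formal properties of the Witt ring `W` of a field that the argument uses: a character
`unary` of a group `G` (the class of `⟨a⟩`, for `a ∈ Fˣ`) whose values generate `W` as a group,
the fundamental ideal `I`, and the class of an element of `G` in a vector space `V` over the
field with two elements (here `Fˣ/±Fˣ²`) that determines `unary` up to sign. -/
structure SymbolRing (G W V : Type*) [CommGroup G] [CommRing W] [AddCommGroup V]
    [Module (ZMod 2) V] where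
  ideal : Ideal W
  unary : G →* W
  negOne : G
  signedClass : G → V
  unary_negOne : unary negOne = -1
  unary_mul_self (a : G) : unary a * unary a = 1
  one_sub_unary_mem (a : G) : 1 - unary a ∈ ideal
  even_of_intCast_mem (k : ℤ) : (k : W) ∈ ideal → Even k
  exists_int_sub_mem_closure (x : W) :
    ∃ k : ℤ, x - (k : W) ∈ AddSubgroup.closure (Set.range fun a => 1 - unary a)
  signedClass_surjective : Function.Surjective signedClass
  signedClass_mul (a b : G) : signedClass (a * b) = signedClass a + signedClass b
  signedClass_negOne : signedClass negOne = 0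
  unary_of_signedClass_eq_zero (a : G) : signedClass a = 0 → unary a = 1 ∨ unary a = -1

namespace SymbolRing

variable {G W V : Type*} [CommGroup G] [CommRing W] [AddCommGroup V] [Module (ZMod 2) V]
variable (D : SymbolRing G W V)

theorem signedClass_one : D.signedClass 1 = 0 := by
  simpa using D.signedClass_mul 1 1

theorem signedClass_mul_inv (a b : G) :
    D.signedClass (a * b⁻¹) = D.signedClass a - D.signedClass b := by
  rw [eq_sub_iff_add_eq, ← D.signedClass_mul, inv_mul_cancel_right]

/-- The class of `⟨1, -a⟩`. With this sign, `a ↦ ⟨1, -a⟩` is additive modulo `I²`. -/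
def binary (a : G) : W := 1 - D.unary a

theorem binary_one : D.binary 1 = 0 := by simp [binary]

theorem binary_negOne : D.binary D.negOne = 2 := by
  rw [binary, D.unary_negOne]; ring

theorem binary_mul (a b : G) :
    D.binary (a * b) = D.binary a + D.binary b - D.binary a * D.binary b := by
  simp only [binary, map_mul]; ring

theorem binary_mul_self (a : G) : D.binary a * D.binary a = 2 * D.binary a := by
  simp only [binary]
  linear_combination D.unary_mul_self a

theorem binary_mem (a : G) : D.binary a ∈ D.ideal := D.one_sub_unary_mem a

theorem two_mem : (2 : W) ∈ D.ideal := D.binary_negOne ▸ D.binary_mem _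

theorem binary_of_signedClass_eq_zero {a : G} (h : D.signedClass a = 0) :
    D.binary a = 0 ∨ D.binary a = 2 := by
  refine (D.unary_of_signedClass_eq_zero a h).imp (fun h => ?_) fun h => ?_
  · rw [binary, h, sub_self]
  · rw [binary, h]; ring

theorem mul_mem_pow_succ {n : ℕ} {x y : W} (hx : x ∈ D.ideal) (hy : y ∈ D.ideal ^ n) :
    x * y ∈ D.ideal ^ (n + 1) := by
  rw [pow_succ']; exact Ideal.mul_mem_mul hx hy

theorem mul_mem_sq {x y : W} (hx : x ∈ D.ideal) (hy : y ∈ D.ideal) : x * y ∈ D.ideal ^ 2 :=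
  D.mul_mem_pow_succ hx (by rwa [pow_one])

theorem closure_binary_le :
    AddSubgroup.closure (Set.range D.binary) ≤ D.ideal.toAddSubgroup := by
  rw [AddSubgroup.closure_le]
  rintro _ ⟨a, rfl⟩
  exact D.binary_mem a

/-- The fundamental ideal is generated, already as a group, by the classes `⟨1, -a⟩`. -/
theorem mem_closure_binary {x : W} (hx : x ∈ D.ideal) :
    x ∈ AddSubgroup.closure (Set.range D.binary) := by
  obtain ⟨k, hk⟩ := D.exists_int_sub_mem_closure x
  have hkI : (k : W) ∈ D.ideal := by
    simpa using sub_mem hx (D.closure_binary_le hk)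
  obtain ⟨l, rfl⟩ := D.even_of_intCast_mem k hkI
  have h2 : (2 : W) ∈ AddSubgroup.closure (Set.range D.binary) :=
    AddSubgroup.subset_closure ⟨D.negOne, D.binary_negOne⟩
  have h : x = x - ((l + l : ℤ) : W) + l • 2 := by rw [zsmul_eq_mul]; push_cast; ring
  rw [h]
  exact add_mem hk (zsmul_mem h2 l)

/-! ### Symbols with entries in a subspace -/

/-- The group of those classes of `Iⁿ` that are, modulo `Iⁿ⁺¹`, sums of symbols
`⟨1, -a₁⟩ ⊗ ⋯ ⊗ ⟨1, -aₙ⟩` with all `aᵢ` in the subspace `P`; in degree `0` it is the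
whole ring, as every class is an integer modulo `I`. -/
def symbolGroup (P : Submodule (ZMod 2) V) : ℕ → AddSubgroup W
  | 0 => ⊤
  | n + 1 => AddSubgroup.closure
      {z | ∃ a y, D.signedClass a ∈ P ∧ y ∈ symbolGroup P n ∧ z = D.binary a * y} ⊔
        (D.ideal ^ (n + 2)).toAddSubgroup

variable {P Q : Submodule (ZMod 2) V} {n : ℕ}

theorem binary_mul_mem_symbolGroup {a : G} (ha : D.signedClass a ∈ P) {y : W}
    (hy : y ∈ D.symbolGroup P n) : D.binary a * y ∈ D.symbolGroup P (n + 1) :=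
  AddSubgroup.mem_sup_left (AddSubgroup.subset_closure ⟨a, y, ha, hy, rfl⟩)

theorem mem_symbolGroup_of_mem_pow {x : W} (hx : x ∈ D.ideal ^ (n + 1)) :
    x ∈ D.symbolGroup P n := by
  cases n with
  | zero => exact AddSubgroup.mem_top x
  | succ n => exact AddSubgroup.mem_sup_right hx

theorem symbolGroup_le_pow : D.symbolGroup P n ≤ (D.ideal ^ n).toAddSubgroup := by
  induction n with
  | zero => simp
  | succ n ih =>
    refine sup_le ((AddSubgroup.closure_le _).2 ?_) (Ideal.pow_le_pow_right (by omega))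
    rintro _ ⟨a, y, -, hy, rfl⟩
    exact D.mul_mem_pow_succ (D.binary_mem a) (ih hy)

/-- An additive subgroup contains `D.symbolGroup P (n + 1)` as soon as it contains the generators
and `Iⁿ⁺²`. -/
theorem symbolGroup_succ_le {S : AddSubgroup W}
    (h1 : ∀ a y, D.signedClass a ∈ P → y ∈ D.symbolGroup P n → D.binary a * y ∈ S)
    (h2 : ∀ x ∈ D.ideal ^ (n + 2), x ∈ S) : D.symbolGroup P (n + 1) ≤ S := by
  refine sup_le ((AddSubgroup.closure_le _).2 ?_) h2
  rintro _ ⟨a, y, ha, hy, rfl⟩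
  exact h1 a y ha hy

theorem mem_symbolGroup_top {x : W} (hx : x ∈ D.ideal ^ n) :
    x ∈ D.symbolGroup ⊤ n := by
  induction n generalizing x with
  | zero => exact AddSubgroup.mem_top x
  | succ n ih =>
    rw [pow_succ'] at hx
    induction hx using Submodule.mul_induction_on' with
    | mem_mul_mem y hy z hz =>
      replace hy := D.mem_closure_binary hy
      induction hy using AddSubgroup.closure_induction with
      | mem y h =>
        obtain ⟨a, rfl⟩ := h
        exact D.binary_mul_mem_symbolGroup Submodule.mem_top (ih hz)
      | zero => rw [zero_mul]; exact zero_mem _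
      | add y y' hy hy' h h' =>
        rw [add_mul]
        exact add_mem h h'
      | neg y hy h => rw [neg_mul]; exact neg_mem h
    | add y _ z _ hy hz => exact add_mem hy hz

theorem mul_mem_symbolGroup {x y : W} (hx : x ∈ D.ideal)
    (hy : y ∈ D.symbolGroup P n) : x * y ∈ D.symbolGroup Q n :=
  D.mem_symbolGroup_of_mem_pow (D.mul_mem_pow_succ hx (D.symbolGroup_le_pow hy))

/-- Enlarging the space of admissible entries by the class of one element `e`: by bilinearity and
`⟨1, -e⟩ ⊗ ⟨1, -e⟩ = 2⟨1, -e⟩ = ⟨1, -(-1)⟩ ⊗ ⟨1, -e⟩`, at most one entry of a symbol has to be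
`e`. -/
theorem exists_add_of_mem_symbolGroup {e : G}
    (hPQ : ∀ v ∈ P, v ∈ Q ∨ v - D.signedClass e ∈ Q) {z : W}
    (hz : z ∈ D.symbolGroup P (n + 1)) :
    ∃ x ∈ D.symbolGroup Q (n + 1), ∃ y ∈ D.symbolGroup Q n, z = x + D.binary e * y := by
  let S (m : ℕ) : AddSubgroup W :=
    D.symbolGroup Q (m + 1) ⊔ (D.symbolGroup Q m).map (AddMonoidHom.mulLeft (D.binary e))
  have hS {m : ℕ} {w : W} : w ∈ S m ↔
      ∃ x ∈ D.symbolGroup Q (m + 1), ∃ y ∈ D.symbolGroup Q m, x + D.binary e * y = w := by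
    simp [S, AddSubgroup.mem_sup]
  suffices h : D.symbolGroup P (n + 1) ≤ S n by
    obtain ⟨x, hx, y, hy, h⟩ := hS.1 (h hz)
    exact ⟨x, hx, y, hy, h.symm⟩
  clear hz z
  -- `a` is either admissible for `Q` or the product of `e` with an admissible element
  have hcase (a : G) (ha : D.signedClass a ∈ P) :
      D.signedClass a ∈ Q ∨ ∃ b, D.signedClass b ∈ Q ∧ a = b * e := by
    refine (hPQ _ ha).imp_right fun h => ⟨a * e⁻¹, ?_, by group⟩
    rwa [D.signedClass_mul_inv]
  have hneg : D.signedClass D.negOne ∈ Q := by rw [D.signedClass_negOne]; exact zero_mem Q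
  induction n with
  | zero =>
    refine D.symbolGroup_succ_le (fun a y ha _ => hS.2 ?_) fun x hx =>
      AddSubgroup.mem_sup_left (D.mem_symbolGroup_of_mem_pow hx)
    have hy : y ∈ D.symbolGroup Q 0 := AddSubgroup.mem_top y
    rcases hcase a ha with hb | ⟨b, hb, rfl⟩
    · exact ⟨_, D.binary_mul_mem_symbolGroup hb hy, 0, zero_mem _, by ring⟩
    · exact ⟨_, D.binary_mul_mem_symbolGroup hb hy, y - D.binary b * y, AddSubgroup.mem_top _, by
        rw [D.binary_mul]; ring⟩
  | succ n ih =>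
    refine D.symbolGroup_succ_le (fun a w ha hw => hS.2 ?_) fun x hx =>
      AddSubgroup.mem_sup_left (D.mem_symbolGroup_of_mem_pow hx)
    obtain ⟨x, hx, y, hy, rfl⟩ := hS.1 (ih hw)
    rcases hcase a ha with hb | ⟨b, hb, rfl⟩
    · exact ⟨_, D.binary_mul_mem_symbolGroup hb hx, _, D.binary_mul_mem_symbolGroup hb hy, by ring⟩
    · refine ⟨_, D.binary_mul_mem_symbolGroup hb hx,
        D.binary b * y + x - D.binary b * x +
          (D.binary D.negOne * y - D.binary D.negOne * (D.binary b * y)), ?_, ?_⟩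
      · exact add_mem (sub_mem (add_mem (D.binary_mul_mem_symbolGroup hb hy) hx)
            (D.mul_mem_symbolGroup (D.binary_mem b) hx))
          (sub_mem (D.binary_mul_mem_symbolGroup hneg hy)
            (D.binary_mul_mem_symbolGroup hneg (D.mul_mem_symbolGroup (D.binary_mem b) hy)))
      · rw [D.binary_mul, D.binary_negOne]
        linear_combination (-y + D.binary b * y) * D.binary_mul_self e

/-- Modulo `I²` sums of classes `⟨1, -a⟩` are again of this form. -/
theorem exists_binary_of_mem_symbolGroup_one {z : W} (hz : z ∈ D.symbolGroup P 1) :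
    ∃ a, D.signedClass a ∈ P ∧ z - D.binary a ∈ D.ideal ^ 2 := by
  have mem_two {a b : G} : D.binary a * D.binary b ∈ D.ideal ^ 2 :=
    D.mul_mem_sq (D.binary_mem a) (D.binary_mem b)
  let S : AddSubgroup W :=
    { carrier := {z | ∃ a, D.signedClass a ∈ P ∧ z - D.binary a ∈ D.ideal ^ 2}
      zero_mem' := ⟨1, by simp [D.signedClass_one], by simp [D.binary_one]⟩
      add_mem' := by
        rintro x y ⟨a, ha, hx⟩ ⟨b, hb, hy⟩
        refine ⟨a * b, by rw [D.signedClass_mul]; exact add_mem ha hb, ?_⟩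
        convert add_mem (add_mem hx hy) (mem_two (a := a) (b := b)) using 1
        rw [D.binary_mul]; ring
      neg_mem' := by
        rintro x ⟨a, ha, hx⟩
        refine ⟨a, ha, ?_⟩
        convert neg_mem (add_mem hx (mem_two (a := a) (b := a))) using 1
        rw [D.binary_mul_self]; ring }
  refine D.symbolGroup_succ_le (S := S) (fun a y ha _ => ?_) (fun x hx => ?_) hz
  · obtain ⟨k, hk⟩ := D.exists_int_sub_mem_closure y
    have h1 : D.binary a ∈ S := ⟨a, ha, by simp⟩
    have h2 : D.binary a * (y - k) ∈ S := ⟨1, by simp [D.signedClass_one], by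
      rw [D.binary_one, sub_zero]
      exact D.mul_mem_sq (D.binary_mem a) (D.closure_binary_le hk)⟩
    convert add_mem (zsmul_mem h1 k) h2 using 1
    rw [zsmul_eq_mul]; ring
  · exact ⟨1, by simp [D.signedClass_one], by simpa [D.binary_one] using hx⟩

/-- The only symbols with entries of class `0` are `0` and `⟨1, 1⟩ ⊗ ⋯ ⊗ ⟨1, 1⟩`, which `2` kills
modulo `Iⁿ⁺¹`. -/
theorem symbolGroup_bot {z : W} (hz : z ∈ D.symbolGroup ⊥ n) :
    z ∈ D.ideal ^ (n + 1) ∨ z - 2 ^ n ∈ D.ideal ^ (n + 1) := by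
  have two_pow (m : ℕ) : (2 : W) ^ m ∈ D.ideal ^ m :=
    Ideal.pow_mem_pow D.two_mem m
  induction n generalizing z with
  | zero =>
    obtain ⟨k, hk⟩ := D.exists_int_sub_mem_closure z
    replace hk := D.closure_binary_le hk
    rcases Int.even_or_odd k with ⟨l, rfl⟩ | ⟨l, rfl⟩
    · left
      rw [pow_one]
      convert Ideal.add_mem _ hk (Ideal.mul_mem_left _ (l : W) D.two_mem) using 1
      push_cast; ring
    · right
      rw [pow_one]
      convert Ideal.add_mem _ hk (Ideal.mul_mem_left _ (l : W) D.two_mem) using 1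
      push_cast; ring
  | succ n ih =>
    let S : AddSubgroup W :=
      { carrier := {z | z ∈ D.ideal ^ (n + 2) ∨
          z - 2 ^ (n + 1) ∈ D.ideal ^ (n + 2)}
        zero_mem' := Or.inl (zero_mem _)
        add_mem' := by
          rintro x y (hx | hx) (hy | hy)
          · exact Or.inl (add_mem hx hy)
          · right; convert add_mem hx hy using 1; ring
          · right; convert add_mem hx hy using 1; ring
          · left; convert add_mem (add_mem hx hy) (two_pow (n + 2)) using 1; ring
        neg_mem' := by
          rintro x (hx | hx)
          · exact Or.inl (neg_mem hx)
          · right; convert neg_mem (add_mem hx (two_pow (n + 2))) using 1; ring }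
    refine D.symbolGroup_succ_le (S := S) (fun a y ha hy => ?_) (fun x hx => Or.inl hx) hz
    rcases D.binary_of_signedClass_eq_zero ((Submodule.mem_bot _).1 ha) with h | h
    · exact Or.inl (by rw [h, zero_mul]; exact zero_mem _)
    · rw [h]
      refine (ih hy).imp (D.mul_mem_pow_succ D.two_mem) fun h' => ?_
      convert D.mul_mem_pow_succ D.two_mem h' using 1; ring

/-! ### Hyperplanes -/

/-- A hyperplane of `P` not containing a given nonzero vector `v` of `P`. -/
theorem exists_hyperplane {V : Type*} [AddCommGroup V] [Module (ZMod 2) V]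
    [FiniteDimensional (ZMod 2) V] {P : Submodule (ZMod 2) V} {v : V} (hv : v ∈ P) (hv0 : v ≠ 0) :
    ∃ Q : Submodule (ZMod 2) V, Module.finrank (ZMod 2) Q + 1 = Module.finrank (ZMod 2) P ∧
      ∀ w ∈ P, w ∈ Q ∨ w - v ∈ Q := by
  obtain ⟨f, hf⟩ := Module.Projective.exists_dual_eq_one (ZMod 2) (x := (⟨v, hv⟩ : P))
    (by simpa using hv0)
  refine ⟨(LinearMap.ker f).map P.subtype, ?_, fun w hw => ?_⟩
  · have hr : LinearMap.range f = ⊤ :=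
      LinearMap.range_eq_top.2 fun c => ⟨c • ⟨v, hv⟩, by rw [map_smul, hf, smul_eq_mul, mul_one]⟩
    have h := f.finrank_range_add_finrank_ker
    rw [hr, finrank_top, Module.finrank_self] at h
    rw [Submodule.finrank_map_subtype_eq, ← h, add_comm]
  · obtain h | h : f ⟨w, hw⟩ = 0 ∨ f ⟨w, hw⟩ = 1 := by
      generalize f ⟨w, hw⟩ = c; revert c; decide
    · exact Or.inl ⟨⟨w, hw⟩, h, rfl⟩
    · exact Or.inr ⟨⟨w, hw⟩ - ⟨v, hv⟩, by simp [h, hf], rfl⟩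

theorem exists_hyperplane_of_finrank_eq_succ [FiniteDimensional (ZMod 2) V] {m : ℕ}
    (hP : Module.finrank (ZMod 2) P = m + 1) :
    ∃ (Q : Submodule (ZMod 2) V) (e : G), Module.finrank (ZMod 2) Q = m ∧
      ∀ w ∈ P, w ∈ Q ∨ w - D.signedClass e ∈ Q := by
  obtain ⟨v, hv, hv0⟩ := P.exists_mem_ne_zero_of_ne_bot (by rintro rfl; simp at hP)
  obtain ⟨Q, hQ, h⟩ := exists_hyperplane hv hv0
  obtain ⟨e, rfl⟩ := D.signedClass_surjective v
  exact ⟨Q, e, by omega, h⟩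

/-! ### Lengths of sums of symbols -/

/-- The elements `c ⟨1, a₁⟩ ⊗ ⋯ ⊗ ⟨1, aₙ⟩` of the ring. -/
def pfisterSet (n : ℕ) : Set W :=
  {x | ∃ (c : G) (a : Fin n → G), x = D.unary c * ∏ i, (1 + D.unary (a i))}

theorem binary_mul_mem_pfisterSet (e : G) {x : W} (hx : x ∈ D.pfisterSet n) :
    D.binary e * x ∈ D.pfisterSet (n + 1) := by
  obtain ⟨c, a, rfl⟩ := hx
  -- `⟨1, -e⟩` is the Pfister form of `-e`
  refine ⟨c, Fin.cons (D.negOne * e) a, ?_⟩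
  simp only [Fin.prod_univ_succ, Fin.cons_zero, Fin.cons_succ, map_mul, D.unary_negOne, binary]
  ring

theorem one_mem_pfisterSet : (1 : W) ∈ D.pfisterSet 0 := ⟨1, 1, by simp⟩

theorem two_pow_mem_pfisterSet (n : ℕ) : (2 : W) ^ n ∈ D.pfisterSet n :=
  ⟨1, 1, by simp [one_add_one_eq_two]⟩

/-- The elements that are, modulo `Iⁿ⁺¹`, the sum of at most `k` elements of `pfisterSet n`. -/
def lengthLE (n k : ℕ) : Set W :=
  {z | ∃ s : Multiset W, s.card ≤ k ∧ (∀ x ∈ s, x ∈ D.pfisterSet n) ∧ z - s.sum ∈ D.ideal ^ (n + 1)}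

variable {D} in
theorem lengthLE_mono {k l : ℕ} (h : k ≤ l) {z : W} (hz : z ∈ D.lengthLE n k) :
    z ∈ D.lengthLE n l := by
  obtain ⟨s, hs, h'⟩ := hz
  exact ⟨s, hs.trans h, h'⟩

theorem mem_lengthLE_zero {z : W} (hz : z ∈ D.ideal ^ (n + 1)) : z ∈ D.lengthLE n 0 :=
  ⟨0, by simp, by simp, by simpa using hz⟩

theorem mem_lengthLE_one {z : W} (hz : z ∈ D.pfisterSet n) : z ∈ D.lengthLE n 1 :=
  ⟨{z}, by simp, by simpa using hz, by simp⟩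

variable {D} in
theorem add_mem_lengthLE {k l : ℕ} {x y : W} (hx : x ∈ D.lengthLE n k) (hy : y ∈ D.lengthLE n l) :
    x + y ∈ D.lengthLE n (k + l) := by
  obtain ⟨s, hs, hs1, hs2⟩ := hx
  obtain ⟨t, ht, ht1, ht2⟩ := hy
  refine ⟨s + t, by rw [Multiset.card_add]; omega, fun z hz => ?_, ?_⟩
  · exact (Multiset.mem_add.1 hz).elim (hs1 z) (ht1 z)
  · convert add_mem hs2 ht2 using 1
    rw [Multiset.sum_add]; ring

variable {D} in
theorem mem_lengthLE_of_sub_mem {k : ℕ} {x y : W} (hx : x ∈ D.lengthLE n k)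
    (h : y - x ∈ D.ideal ^ (n + 1)) : y ∈ D.lengthLE n k := by
  simpa using add_mem_lengthLE hx (D.mem_lengthLE_zero h)

variable {D} in
theorem binary_mul_mem_lengthLE {k : ℕ} (e : G) {x : W} (hx : x ∈ D.lengthLE n k) :
    D.binary e * x ∈ D.lengthLE (n + 1) k := by
  obtain ⟨s, hs, hs1, hs2⟩ := hx
  refine ⟨s.map (D.binary e * ·), by simpa using hs, fun z hz => ?_, ?_⟩
  · obtain ⟨y, hy, rfl⟩ := Multiset.mem_map.1 hz
    exact D.binary_mul_mem_pfisterSet e (hs1 y hy)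
  · rw [Multiset.sum_map_mul_left, Multiset.map_id', ← mul_sub]
    exact D.mul_mem_pow_succ (D.binary_mem e) hs2

theorem binary_mul_binary_mem_lengthLE (a b : G) : D.binary a * D.binary b ∈ D.lengthLE 2 1 := by
  simpa using binary_mul_mem_lengthLE a (binary_mul_mem_lengthLE b
    (D.mem_lengthLE_one D.one_mem_pfisterSet))

/-! ### Bounds for the length -/

/-- The case of degree two, analogous to the normal form of an alternating bilinear form on a space
of dimension `m`, which is a sum of at most `m / 2` decomposable ones. The diagonal
entries `⟨1, -a⟩ ⊗ ⟨1, -a⟩` contribute the single further symbol with first entry `-1`. -/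
theorem exists_of_mem_symbolGroup_two [FiniteDimensional (ZMod 2) V] {m : ℕ}
    {P : Submodule (ZMod 2) V} (hP : Module.finrank (ZMod 2) P = m) {z : W}
    (hz : z ∈ D.symbolGroup P 2) :
    ∃ c, z - D.binary D.negOne * D.binary c ∈ D.lengthLE 2 (m / 2) := by
  induction m using Nat.strong_induction_on generalizing P z with
  | _ m ih =>
  obtain _ | m := m
  · rw [Submodule.finrank_eq_zero] at hP
    subst hP
    rcases D.symbolGroup_bot hz with h | h
    · exact ⟨1, by simpa [binary_one] using D.mem_lengthLE_zero h⟩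
    · exact ⟨D.negOne, D.mem_lengthLE_zero (by rw [D.binary_negOne, ← sq]; exact h)⟩
  obtain ⟨Q, e, hQ, hPQ⟩ := D.exists_hyperplane_of_finrank_eq_succ hP
  obtain ⟨x, hx, y, hy, rfl⟩ := D.exists_add_of_mem_symbolGroup hPQ hz
  obtain ⟨a, ha, hya⟩ := D.exists_binary_of_mem_symbolGroup_one hy
  have hya' := D.mul_mem_pow_succ (D.binary_mem e) hya
  by_cases ha0 : D.signedClass a = 0
  · obtain ⟨c, hc⟩ := ih m (by omega) hQ hx
    -- `{e, a}` is `0` or `{-1, e}`, and `{-1, c} + {-1, e} = {-1, c e}`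
    rcases D.binary_of_signedClass_eq_zero ha0 with h | h
    · refine ⟨c, mem_lengthLE_of_sub_mem (lengthLE_mono (by omega) hc) ?_⟩
      convert hya' using 1
      rw [h]; ring
    · refine ⟨c * e, mem_lengthLE_of_sub_mem (lengthLE_mono (by omega) hc) ?_⟩
      convert add_mem hya' (D.mul_mem_pow_succ D.two_mem
        (D.mul_mem_sq (D.binary_mem c) (D.binary_mem e))) using 1
      rw [h, D.binary_negOne, D.binary_mul]; ring
  · obtain ⟨R, hR, hQR⟩ := exists_hyperplane ha ha0
    obtain ⟨x', hx', y', hy', rfl⟩ := D.exists_add_of_mem_symbolGroup hQR hx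
    obtain ⟨b, -, hyb⟩ := D.exists_binary_of_mem_symbolGroup_one hy'
    obtain ⟨c, hc⟩ := ih (m - 1) (by omega) (by omega) hx'
    refine ⟨c, mem_lengthLE_of_sub_mem (lengthLE_mono (by omega)
      (add_mem_lengthLE hc (D.binary_mul_binary_mem_lengthLE a (b * e)))) ?_⟩
    -- `{e, a} + {a, b} = {a, b e}`
    convert add_mem (add_mem hya' (D.mul_mem_pow_succ (D.binary_mem a) hyb))
      (D.mul_mem_pow_succ (D.binary_mem a) (D.mul_mem_sq (D.binary_mem b) (D.binary_mem e))) using 1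
    rw [D.binary_mul]; ring

/-- Twice the bound for the symbol length of degree `k + 2` with entries from a space of
dimension `m`; the factor clears the denominator of the leading term. -/
def doubledBound (k m : ℕ) : ℕ := m.choose (k + 1) + 2 * ∑ j ∈ Finset.range (k + 1), m.choose j

theorem doubledBound_succ_succ (k m : ℕ) :
    doubledBound (k + 1) (m + 1) = doubledBound (k + 1) m + doubledBound k m := by
  have h : ∑ j ∈ Finset.range (k + 2), (m + 1).choose j =
      ∑ j ∈ Finset.range (k + 2), m.choose j + ∑ j ∈ Finset.range (k + 1), m.choose j := by
    rw [Finset.sum_range_succ', Finset.sum_range_succ' _ (k + 1)]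
    simp only [Nat.choose_succ_succ', Finset.sum_add_distrib, Nat.choose_zero_right]
    ring
  simp only [doubledBound, h, Nat.choose_succ_succ' m (k + 1)]
  ring

theorem two_le_doubledBound (k m : ℕ) : 2 ≤ doubledBound k m := by
  rw [doubledBound, Finset.sum_range_succ', Nat.choose_zero_right]
  omega

/-- The bound for every degree `≥ 2`: splitting off a hyperplane of the space of entries gives the
recursion `doubledBound_succ_succ`, which starts in degree two. -/
theorem mem_lengthLE_of_mem_symbolGroup [FiniteDimensional (ZMod 2) V] {k m : ℕ}
    {P : Submodule (ZMod 2) V} (hP : Module.finrank (ZMod 2) P = m) {z : W}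
    (hz : z ∈ D.symbolGroup P (k + 2)) :
    z ∈ D.lengthLE (k + 2) (doubledBound k m / 2) := by
  induction k generalizing P m z with
  | zero =>
    obtain ⟨c, hc⟩ := D.exists_of_mem_symbolGroup_two hP hz
    have h := add_mem_lengthLE hc (D.binary_mul_binary_mem_lengthLE D.negOne c)
    rw [sub_add_cancel] at h
    refine lengthLE_mono ?_ h
    simp only [doubledBound, zero_add, Nat.choose_one_right, Finset.range_one,
      Finset.sum_singleton, Nat.choose_zero_right]
    omega
  | succ k ihk =>
    induction m generalizing P z with
    | zero =>
      rw [Submodule.finrank_eq_zero] at hP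
      subst hP
      have h2 := two_le_doubledBound (k + 1) 0
      rcases D.symbolGroup_bot hz with h | h
      · exact lengthLE_mono (by omega) (D.mem_lengthLE_zero h)
      · exact lengthLE_mono (by omega)
          (mem_lengthLE_of_sub_mem (D.mem_lengthLE_one (D.two_pow_mem_pfisterSet _)) h)
    | succ m ihm =>
      obtain ⟨Q, e, hQ, hPQ⟩ := D.exists_hyperplane_of_finrank_eq_succ hP
      obtain ⟨x, hx, y, hy, rfl⟩ := D.exists_add_of_mem_symbolGroup hPQ hz
      refine lengthLE_mono ?_ (add_mem_lengthLE (ihm hQ hx) (binary_mul_mem_lengthLE e (ihk hQ hy)))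
      rw [doubledBound_succ_succ]
      omega

end SymbolRing

end Abstract

/-! ### The Witt ring -/

section WittRing

variable {F : Type*} [Field F]

/-- The Witt class of the one-dimensional form `⟨a⟩`, multiplicative in `a`. -/
noncomputable def unary : Fˣ →* WittRing F :=
  (Ideal.Quotient.mk (wittIdeal F)).toMonoidHom.comp (MonoidAlgebra.of ℤ Fˣ)

theorem diag_eq_sum {n : ℕ} (w : Fin n → Fˣ) : diag w = ∑ i, unary (w i) := by
  simp [diag, formalDiag, unary]

theorem unary_neg_one : unary (-1 : Fˣ) = -1 := by
  have h : diag ![(1 : Fˣ), -1] = 0 :=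
    Ideal.Quotient.eq_zero_iff_mem.2 (Ideal.subset_span (Or.inr rfl))
  rw [diag_eq_sum, Fin.sum_univ_two] at h
  simp only [Matrix.cons_val_zero, Matrix.cons_val_one, map_one] at h
  linear_combination h

theorem unary_mul_self (a : Fˣ) : unary a * unary a = 1 := by
  have h : diag ![a * a] = diag ![(1 : Fˣ)] := by
    refine Ideal.Quotient.eq.2 (Ideal.subset_span (Or.inl ⟨1, 1, _, _, ⟨?_⟩, rfl⟩))
    -- multiplication by `a` is an isometry from `⟨a²⟩` to `⟨1⟩`
    refine ⟨LinearEquiv.smulOfUnit a, fun x => ?_⟩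
    simp [QuadraticMap.weightedSumSquares_apply, LinearEquiv.smulOfUnit, Units.smul_def]
    ring
  simpa [diag_eq_sum] using h

theorem one_sub_unary_mem (a : Fˣ) : 1 - unary a ∈ fundamentalIdeal F := by
  have h : dimModTwoAux F (1 - MonoidAlgebra.single a 1) = 0 := by
    simp [dimModTwoAux]
  exact h

theorem even_of_intCast_mem (k : ℤ) (h : (k : WittRing F) ∈ fundamentalIdeal F) : Even k := by
  have h' : (k : ZMod 2) = 0 := (map_intCast (dimModTwoAux F) k).symm.trans h
  exact even_iff_two_dvd.2 ((ZMod.intCast_zmod_eq_zero_iff_dvd k 2).1 h')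

/-- Every Witt class differs from an integer by a combination of classes `⟨1, -a⟩`, because
`⟨a⟩ = 1 - ⟨1, -a⟩`. -/
theorem exists_int_sub_mem_closure (x : WittRing F) : ∃ k : ℤ, x - (k : WittRing F) ∈
    AddSubgroup.closure (Set.range fun a : Fˣ => 1 - unary a) := by
  obtain ⟨y, rfl⟩ := Ideal.Quotient.mk_surjective x
  induction y using MonoidAlgebra.induction_on with
  | of a =>
    refine ⟨1, ?_⟩
    have h := neg_mem (AddSubgroup.subset_closure
      (Set.mem_range_self (f := fun a : Fˣ => 1 - unary a) a))
    rw [neg_sub] at h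
    simpa [unary] using h
  | add y z hy hz =>
    obtain ⟨k, hk⟩ := hy
    obtain ⟨l, hl⟩ := hz
    refine ⟨k + l, ?_⟩
    convert add_mem hk hl using 1
    rw [map_add]; push_cast; ring
  | smul r y hy =>
    obtain ⟨k, hk⟩ := hy
    refine ⟨r * k, ?_⟩
    convert zsmul_mem hk r using 1
    rw [map_zsmul, smul_sub]
    exact congrArg _
      ((Int.cast_mul (α := WittRing F) r k).trans (zsmul_eq_mul (k : WittRing F) r).symm)

theorem unary_of_mem_signedSquares {a : Fˣ} (h : a ∈ signedSquares F) :
    unary a = 1 ∨ unary a = -1 := by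
  obtain ⟨b, ⟨c, rfl⟩, e, he, rfl⟩ := Subgroup.mem_sup.1 h
  have hc : unary (c * c) = 1 := by rw [map_mul, unary_mul_self]
  obtain ⟨m, rfl⟩ := Subgroup.mem_zpowers_iff.1 he
  rcases Int.even_or_odd m with hm | hm
  · left; rw [hm.neg_one_zpow, mul_one, hc]
  · right; rw [hm.neg_one_zpow, map_mul, hc, unary_neg_one]; exact one_mul (-1 : WittRing F)

variable (F) in
/-- The Witt ring as a ring generated by the classes of one-dimensional forms. -/
noncomputable def wittSymbolRing : SymbolRing Fˣ (WittRing F) (SignedSquareClassGroup F) where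
  ideal := fundamentalIdeal F
  unary := unary
  negOne := -1
  signedClass a := Additive.ofMul (QuotientGroup.mk a)
  unary_negOne := unary_neg_one
  unary_mul_self := unary_mul_self
  one_sub_unary_mem := one_sub_unary_mem
  even_of_intCast_mem := even_of_intCast_mem
  exists_int_sub_mem_closure := exists_int_sub_mem_closure
  signedClass_surjective v := QuotientGroup.mk_surjective v.toMul
  signedClass_mul _ _ := rfl
  signedClass_negOne := (QuotientGroup.eq_one_iff _).2
    (Subgroup.mem_sup_right (Subgroup.mem_zpowers _))
  unary_of_signedClass_eq_zero a h :=
    unary_of_mem_signedSquares ((QuotientGroup.eq_one_iff a).1 h)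

theorem pfisterSet_eq (n : ℕ) : (wittSymbolRing F).pfisterSet n = generalPfister F n := by
  ext x
  simp [SymbolRing.pfisterSet, generalPfister, pfister, diag_eq_sum, wittSymbolRing]

theorem symbolLength_le {n k : ℕ} {φ : WittRing F} (h : φ ∈ (wittSymbolRing F).lengthLE n k) :
    symbolLength n φ ≤ k := by
  obtain ⟨s, hs, h1, h2⟩ := h
  obtain ⟨l, rfl⟩ := Quot.exists_rep s
  refine le_trans (sInf_le ?_) (Nat.cast_le.2 hs)
  refine ⟨l.length, l.get, rfl, fun i => ?_, ?_⟩
  · rw [← pfisterSet_eq]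
    exact h1 _ (List.get_mem l i)
  · rw [← List.sum_ofFn, List.ofFn_get]
    exact h2

theorem finiteDimensional_signedSquareClassGroup (h : Finite (SquareClassGroup F)) :
    FiniteDimensional (ZMod 2) (SignedSquareClassGroup F) := by
  have h' : Finite (Fˣ ⧸ signedSquares F) :=
    Finite.of_surjective (Subgroup.quotientMapOfLE le_sup_left)
      (fun y => by
        obtain ⟨a, rfl⟩ := QuotientGroup.mk_surjective y
        exact ⟨QuotientGroup.mk a, rfl⟩)
  have : Finite (SignedSquareClassGroup F) := h'
  infer_instance

theorem fieldSymbolLength_le (h : Finite (SquareClassGroup F)) (k : ℕ) :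
    fieldSymbolLength F (k + 2) ≤
      (SymbolRing.doubledBound k (dimSignedSquareClasses F) / 2 : ℕ) := by
  have := finiteDimensional_signedSquareClassGroup h
  refine iSup₂_le fun φ hφ => symbolLength_le ?_
  exact (wittSymbolRing F).mem_lengthLE_of_mem_symbolGroup
    (finrank_top _ _) ((wittSymbolRing F).mem_symbolGroup_top hφ)

end WittRing

theorem doubledBound_le (k m : ℕ) : (SymbolRing.doubledBound k m : ℝ) ≤
    (m : ℝ) ^ (k + 1) / (k + 1).factorial + 2 * ∑ j ∈ Finset.range (k + 1), (m : ℝ) ^ j := by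
  rw [SymbolRing.doubledBound]
  push_cast
  gcongr with j
  · exact Nat.choose_le_pow_div _ _
  · exact_mod_cast Nat.choose_le_pow _ _

end WittTheory

theorem mainTheorem2 (n : ℕ) (hn : 2 ≤ n) :
    ∃ f : Polynomial ℝ, f.natDegree ≤ n - 2 ∧
      ∀ (F : Type*) [Field F], ringChar F ≠ 2 →
        ∀ d : ℕ, Nat.card (WittTheory.SquareClassGroup F) = 2 ^ d →
          ∃ N : ℕ, WittTheory.fieldSymbolLength F n = (N : ℕ∞) ∧
            (N : ℝ) ≤
              (WittTheory.dimSignedSquareClasses F : ℝ) ^ (n - 1) /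
                  (2 * (Nat.factorial (n - 1) : ℝ)) +
                f.eval (WittTheory.dimSignedSquareClasses F : ℝ) := by
  obtain ⟨k, rfl⟩ := Nat.exists_eq_add_of_le' hn
  refine ⟨∑ j ∈ Finset.range (k + 1), Polynomial.X ^ j, ?_, fun F _ _ d hd => ?_⟩
  · refine Polynomial.natDegree_sum_le_of_forall_le _ _ fun j hj => ?_
    rw [Polynomial.natDegree_X_pow]
    have := Finset.mem_range.1 hj
    omega
  · have hfin : Finite (WittTheory.SquareClassGroup F) :=
      Nat.finite_of_card_ne_zero (by rw [hd]; positivity)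
    have hle := WittTheory.fieldSymbolLength_le hfin k
    obtain ⟨N, hN⟩ := ENat.ne_top_iff_exists.1 (ne_top_of_le_ne_top (ENat.natCast_ne_top _) hle)
    refine ⟨N, hN.symm, ?_⟩
    rw [← hN, Nat.cast_le] at hle
    have h2 : 2 * N ≤ WittTheory.SymbolRing.doubledBound k (WittTheory.dimSignedSquareClasses F) := by
      omega
    have h3 : (2 * N : ℝ) ≤ _ :=
      le_trans (by exact_mod_cast h2) (WittTheory.doubledBound_le k _)
    simp only [Polynomial.eval_finsetSum, Polynomial.eval_pow, Polynomial.eval_X,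
      Nat.reduceSubDiff]
    rw [mul_comm (2 : ℝ), ← div_div]
    linarith
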